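/- Let $m$ be a positive integer and let $F=\mathbb{F}_{2^m}$ be the finite field with $2^m$ elements. For $a\in F$ let $$K(a)=\sum_{x\in F\setminus\{0\}}(-1)^{\mathrm{Tr}(ax+1/x)},$$ where $\mathrm{Tr}$ is the trace of $F$ over $\mathbb{F}_2$. For $b\in F$ and a rational number $r=p/d$ in lowest terms with $d>0$, a value of $b^r$ in $F$ is an element $x\in F$ with $x^d=b^p$ (there is no value if $b=0$ and $r<0$, and $0^0=1$). Let $b\in F$, and let $n,k$ be rational numbers such that $b^n$ and $b^k$ have values in $F$. Fix any such values, denoted $b^n$ and $b^k$, and put $b^{n+2}=b^n\cdot b^2$ and $b^{4n}=(b^n)^4$. If $b^{4n}+1\neq 0$, then $$K\left(\frac{(b^{n+2}+b^k+1)(b^{n+2}+b^n+b^k)^3}{b^{4n}+1}\right)=K\left(\frac{(b^{n+2}+b^k+1)^3(b^{n+2}+b^n+b^k)}{b^{4n}+1}\right).$$ -/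

import Mathlib

/-- The binary Kloosterman sum `K(a) = ∑_{x ≠ 0} (-1)^{Tr(ax + 1/x)}` over a finite field `F` of
characteristic two, where `Tr` is the trace of `F` over its prime field with two elements. The same
formula is used for `a = 0`. -/
noncomputable def kloostermanSum {F : Type*} [Field F] [Fintype F] [DecidableEq F] [Algebra (ZMod 2) F]
    (a : F) : ℤ :=
  ∑ x ∈ (Finset.univ : Finset F).erase 0, (-1 : ℤ) ^ (Algebra.trace (ZMod 2) F (a * x + 1 / x)).val

/-- `IsRatPow b r x`: the element `x` is a value in `F` of the power `b ^ r` with rational exponent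
`r = p / d` (in lowest terms, `d > 0`), that is, `x ^ d = b ^ p`. There may be several such values,
or none. A negative power of `0` has no value, and `0 ^ 0 = 1`. -/
def IsRatPow {F : Type*} [Field F] (b : F) (r : ℚ) (x : F) : Prop :=
  (b = 0 → 0 ≤ r) ∧ x ^ r.den = b ^ r.num

/-- If `x` is a value of `b ^ r`, then `x * b ^ 2` is a value of `b ^ (r + 2)`. -/
theorem IsRatPow.mul_sq {F : Type*} [Field F] {b : F} {r : ℚ} {x : F} (h : IsRatPow b r x) :
    IsRatPow b (r + 2) (x * b ^ 2) := by
  obtain ⟨h0, h1⟩ := h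
  have hd : (r + 2).den = r.den := by simp
  have hn : (r + 2).num = r.num + 2 * r.den := by
    have e : ((r + 2).num : ℚ) = r.num + 2 * r.den := by
      have e1 := Rat.mul_den_eq_num (r + 2)
      have e2 := Rat.mul_den_eq_num r
      rw [hd] at e1
      rw [← e1, ← e2]
      ring
    exact_mod_cast e
  refine ⟨fun hb => by linarith [h0 hb], ?_⟩
  rw [hd, hn, mul_pow, h1]
  by_cases hb : b = 0
  · have hnum : 0 ≤ r.num := Rat.num_nonneg.mpr (h0 hb)
    have hden : 0 < r.den := r.den_pos
    have hden' : (0 : ℤ) < r.den := by exact_mod_cast hden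
    have hne : r.num + 2 * (r.den : ℤ) ≠ 0 := (by linarith : 0 < r.num + 2 * (r.den : ℤ)).ne'
    subst hb
    rw [zero_zpow _ hne]
    simp [hden.ne']
  · rw [zpow_add₀ hb, ← pow_mul]
    congr 1
    exact_mod_cast (zpow_natCast b (2 * r.den)).symm

/-- If `x` is a value of `b ^ r`, then `x ^ 4` is a value of `b ^ (4 * r)`. -/
theorem IsRatPow.pow_four {F : Type*} [Field F] {b : F} {r : ℚ} {x : F} (h : IsRatPow b r x) :
    IsRatPow b (4 * r) (x ^ 4) := by
  obtain ⟨h0, h1⟩ := h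
  have hdvd : (4 * r).den ∣ r.den := by simpa using Rat.mul_den_dvd 4 r
  obtain ⟨g, hg⟩ := hdvd
  have hnum : (4 * r).num * g = 4 * r.num := by
    have e : ((4 * r).num : ℚ) * g = 4 * r.num := by
      have e1 := Rat.mul_den_eq_num (4 * r)
      have e2 := Rat.mul_den_eq_num r
      have e3 : (r.den : ℚ) = (4 * r).den * g := by exact_mod_cast hg
      rw [← e1, ← e2, e3]
      ring
    exact_mod_cast e
  have hcop : Nat.Coprime g r.num.natAbs :=
    (Nat.Coprime.coprime_dvd_right (Dvd.intro_left _ hg.symm) r.reduced).symm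
  have hg4 : g ∣ 4 := by
    refine hcop.dvd_of_dvd_mul_right ⟨(4 * r).num.natAbs, ?_⟩
    have := congrArg Int.natAbs hnum
    rw [Int.natAbs_mul, Int.natAbs_mul] at this
    simp only [Int.natAbs_natCast] at this
    rw [mul_comm g]
    exact this.symm
  obtain ⟨t, ht⟩ := hg4
  have hg0 : (g : ℤ) ≠ 0 := by
    intro hz
    have : g = 0 := by exact_mod_cast hz
    simp [this] at ht
  have hnum' : (4 * r).num = r.num * t := by
    have ht' : (4 : ℤ) = g * t := by exact_mod_cast ht
    apply mul_right_cancel₀ hg0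
    rw [hnum, ht']
    ring
  refine ⟨fun hb => by linarith [h0 hb], ?_⟩
  rw [hnum', zpow_mul, ← h1, zpow_natCast, ← pow_mul, ← pow_mul, hg]
  congr 1
  calc 4 * (4 * r).den = (g * t) * (4 * r).den := by rw [← ht]
    _ = _ := by ring

/-! With `c = (bn * b ^ 2 + bk + 1) / (bn + 1)` the claim becomes K(c(1+c)³) = K(c³(1+c)). The
fibres Tr(x + a/x) = τ are the x-coordinates of points on an ordinary elliptic curve and its
quadratic twist, and the size of either one determines K(a). The curves for a = c³(1+c) and a =
c(1+c)³ are linked by a 3-isogeny with kernel at x = c². Taking τ = Tr(c) + 1 selects the twist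
without rational kernel points, where the isogeny is injective on x-coordinates. The reverse
inequality of cardinalities depends on Tr(1): if it is 0, exchange c and 1 + c; if it is 1, solve a
cubic to get surjectivity. -/

section BinaryTrace

variable {F : Type*} [Field F] [Fintype F] [Algebra (ZMod 2) F]

theorem trace_sq_add_self (s : F) : Algebra.trace (ZMod 2) F (s ^ 2 + s) = 0 := by
  have : CharP F 2 := charP_of_injective_algebraMap (algebraMap (ZMod 2) F).injective 2
  have h : Algebra.trace (ZMod 2) F (s ^ 2) = Algebra.trace (ZMod 2) F s := by
    have e := Algebra.trace_eq_of_algEquiv (FiniteField.frobeniusAlgEquiv (ZMod 2) F 2) s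
    simpa using e
  rw [map_add, h]
  exact CharTwo.add_self_eq_zero _

/-- Additive Hilbert 90 over the field with two elements. -/
theorem exists_sq_add_self_of_trace_eq_zero {x : F} (hx : Algebra.trace (ZMod 2) F x = 0) :
    ∃ s : F, s ^ 2 + s = x := by
  have : CharP F 2 := charP_of_injective_algebraMap (algebraMap (ZMod 2) F).injective 2
  let P : F →ₗ[ZMod 2] F := (FiniteField.frobeniusAlgHom (ZMod 2) F).toLinearMap + LinearMap.id
  have hP (s : F) : P s = s ^ 2 + s := by simp [P]
  have hker : LinearMap.ker P = Submodule.span (ZMod 2) {(1 : F)} := by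
    ext s
    rw [LinearMap.mem_ker, hP, Submodule.mem_span_singleton]
    constructor
    · intro h
      have h' : s * (s + 1) = 0 := by linear_combination h
      rcases mul_eq_zero.mp h' with h0 | h1
      · exact ⟨0, by simp [h0]⟩
      · exact ⟨1, by simp [CharTwo.add_eq_zero.mp h1]⟩
    · rintro ⟨r, rfl⟩
      rw [Algebra.smul_def, mul_one, ← map_pow, ZMod.pow_card]
      exact CharTwo.add_self_eq_zero _
  have hle : LinearMap.range P ≤ LinearMap.ker (Algebra.trace (ZMod 2) F) := by
    rintro _ ⟨s, rfl⟩
    rw [LinearMap.mem_ker, hP, trace_sq_add_self]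
  have h1 := LinearMap.finrank_range_add_finrank_ker P
  have h2 := LinearMap.finrank_range_add_finrank_ker (Algebra.trace (ZMod 2) F)
  rw [hker, finrank_span_singleton one_ne_zero] at h1
  rw [LinearMap.range_eq_top.mpr (Algebra.trace_surjective (ZMod 2) F), finrank_top,
    Module.finrank_self] at h2
  have heq := Submodule.eq_of_le_of_finrank_eq hle (by omega)
  obtain ⟨s, hs⟩ : x ∈ LinearMap.range P := heq ▸ LinearMap.mem_ker.mpr hx
  exact ⟨s, by rw [← hP, hs]⟩

theorem trace_eq_of_add_eq_sq_add_self {x y s : F} (h : x + y = s ^ 2 + s) :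
    Algebra.trace (ZMod 2) F x = Algebra.trace (ZMod 2) F y := by
  have e := trace_sq_add_self s
  rw [← h, map_add] at e
  exact CharTwo.add_eq_zero.mp e

/-- If `1` has trace `1`, there is no primitive cube root of unity, so every element is a cube. -/
theorem exists_pow_three_eq (h1 : Algebra.trace (ZMod 2) F (1 : F) = 1) (y : F) :
    ∃ x : F, x ^ 3 = y := by
  have : CharP F 2 := charP_of_injective_algebraMap (algebraMap (ZMod 2) F).injective 2
  have hinj : Function.Injective (fun x : F => x ^ 3) := by
    intro x z h
    simp only at h
    by_cases hz : z = 0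
    · subst hz
      simpa using h
    by_contra hne
    have h3 : (x - z) * (x ^ 2 + x * z + z ^ 2) = 0 := by linear_combination h
    have h4 := (mul_eq_zero.mp h3).resolve_left (sub_ne_zero.mpr hne)
    have h5 : (x / z) ^ 2 + x / z = 1 := by
      have h2 : (2 : F) = 0 := CharTwo.two_eq_zero
      field_simp
      linear_combination h4 - z ^ 2 * h2
    have e := trace_sq_add_self (x / z)
    rw [h5, h1] at e
    exact one_ne_zero e
  exact Finite.surjective_of_injective hinj y

/-- The depressed cubic `w ^ 3 + p w + z` has a root when its quadratic resolvent splits. -/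
theorem exists_root_depressed_cubic (h1 : Algebra.trace (ZMod 2) F (1 : F) = 1) {p z : F}
    (hz : z ≠ 0) (h : Algebra.trace (ZMod 2) F (p ^ 3 / z ^ 2) = 0) :
    ∃ w : F, w ^ 3 + p * w + z = 0 := by
  have : CharP F 2 := charP_of_injective_algebraMap (algebraMap (ZMod 2) F).injective 2
  have h2 : (2 : F) = 0 := CharTwo.two_eq_zero
  by_cases hp : p = 0
  · obtain ⟨w, hw⟩ := exists_pow_three_eq h1 z
    exact ⟨w, by rw [hw, hp]; linear_combination z * h2⟩
  -- Cardano: zs and z(s+1) are the roots of the resolvent Y² + zY + p³. If u³ = zs then (p/u)³ =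
  -- z(s+1), so u + p/u is a root of the cubic.
  obtain ⟨s, hs⟩ := exists_sq_add_self_of_trace_eq_zero h
  obtain ⟨u, hu⟩ := exists_pow_three_eq h1 (z * s)
  have hs' : z ^ 2 * (s ^ 2 + s) = p ^ 3 := by
    rw [hs]
    field_simp
  have hu0 : u ≠ 0 := by
    rintro rfl
    have hs0 : s = 0 := by simpa [hz] using hu.symm
    apply hp
    simpa [hs0] using hs'.symm
  refine ⟨u + p / u, ?_⟩
  field_simp
  linear_combination (u ^ 3 + z * s + z) * hu - hs' +
    (2 * p * u ^ 4 + 2 * p ^ 2 * u ^ 2 + z * s * (1 + s) * z) * h2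

end BinaryTrace

/-! ### Trace fibres and the 3-isogeny between them. -/

section Isogeny

variable {F : Type*} [Field F] [Fintype F] [DecidableEq F] [Algebra (ZMod 2) F]

/-- The nonzero `x` with `Tr (x + a / x) = τ`. -/
noncomputable def traceFiber (a : F) (τ : ZMod 2) : Finset F :=
  {x | x ≠ 0 ∧ Algebra.trace (ZMod 2) F (x + a / x) = τ}

theorem mem_traceFiber {a x : F} {τ : ZMod 2} :
    x ∈ traceFiber a τ ↔ x ≠ 0 ∧ Algebra.trace (ZMod 2) F (x + a / x) = τ := by
  simp [traceFiber]

/-- After x ↦ 1/x the summand takes only the values ±1, so one fibre suffices, and τ may be chosen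
freely. -/
theorem kloostermanSum_eq_card_traceFiber (a : F) (τ : ZMod 2) :
    kloostermanSum a =
      (-1) ^ τ.val * (2 * ((traceFiber a τ).card : ℤ) - ((Finset.univ : Finset F).erase 0).card) := by
  have h1 : kloostermanSum a = ∑ x ∈ (Finset.univ : Finset F).erase 0,
      (-1 : ℤ) ^ (Algebra.trace (ZMod 2) F (x + a / x)).val := by
    unfold kloostermanSum
    refine Finset.sum_nbij' (fun x => x⁻¹) (fun x => x⁻¹) ?_ ?_ ?_ ?_ ?_
    · simp
    · simp
    · simp
    · simp
    · intro x _
      rw [one_div, div_inv_eq_mul, add_comm]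
  have h2 : ∀ t : ZMod 2, (-1 : ℤ) ^ t.val = (-1) ^ τ.val * (2 * (if t = τ then 1 else 0) - 1) := by
    revert τ
    decide
  have h3 : traceFiber a τ = ((Finset.univ : Finset F).erase 0).filter
      (fun x => Algebra.trace (ZMod 2) F (x + a / x) = τ) := by
    ext x
    simp [mem_traceFiber]
  rw [h1, Finset.sum_congr rfl (fun x _ => h2 _), ← Finset.mul_sum, Finset.sum_sub_distrib,
    ← Finset.mul_sum, Finset.sum_boole, h3]
  simp

/-- The action on `x`-coordinates of the isogeny of degree three whose kernel contains the points
with `x`-coordinate `c ^ 2`. -/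
def threeIsogeny (c x : F) : F := x * (x + c + c ^ 2) ^ 2 / (x + c ^ 2) ^ 2

/-- At the pole x = c² and at the zero x = c + c² of the isogeny, x + a/x equals c, which has the
wrong trace. -/
theorem add_ne_zero_of_mem_traceFiber {c x : F}
    (hx : x ∈ traceFiber (c ^ 3 * (1 + c)) (Algebra.trace (ZMod 2) F c + 1)) :
    x + c ^ 2 ≠ 0 ∧ x + c + c ^ 2 ≠ 0 := by
  have : CharP F 2 := charP_of_injective_algebraMap (algebraMap (ZMod 2) F).injective 2
  have h2 : (2 : F) = 0 := CharTwo.two_eq_zero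
  obtain ⟨hx0, hx⟩ := mem_traceFiber.mp hx
  constructor
  · intro h
    have e : x = c ^ 2 := CharTwo.add_eq_zero.mp h
    rw [trace_eq_of_add_eq_sq_add_self (y := c) (s := 0)] at hx
    · simp at hx
    · subst e
      field_simp
      linear_combination (c + c ^ 2) * h2
  · intro h
    have e : x = c * (1 + c) := by
      have : x + c * (1 + c) = 0 := by linear_combination h
      exact CharTwo.add_eq_zero.mp this
    rw [trace_eq_of_add_eq_sq_add_self (y := c) (s := 0)] at hx
    · simp at hx
    · subst e
      have hc1 := right_ne_zero_of_mul hx0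
      field_simp
      linear_combination (c + c ^ 2) * h2

omit [DecidableEq F] in
theorem trace_threeIsogeny {c x : F} (hx0 : x ≠ 0) (h1 : x + c ^ 2 ≠ 0)
    (h2 : x + c + c ^ 2 ≠ 0) :
    Algebra.trace (ZMod 2) F (threeIsogeny c x + c * (1 + c) ^ 3 / threeIsogeny c x) =
      Algebra.trace (ZMod 2) F (x + c ^ 3 * (1 + c) / x) := by
  have : CharP F 2 := charP_of_injective_algebraMap (algebraMap (ZMod 2) F).injective 2
  have two : (2 : F) = 0 := CharTwo.two_eq_zero
  -- The first summand of s accounts for the change in x, the second for the change in a/x.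
  apply trace_eq_of_add_eq_sq_add_self (s := c ^ 2 / (x + c ^ 2) + (c + c ^ 2) / (x + c + c ^ 2))
  have e1 : threeIsogeny c x + x = (c ^ 2 / (x + c ^ 2)) ^ 2 + c ^ 2 / (x + c ^ 2) := by
    unfold threeIsogeny
    field_simp
    grind
  have e2 : c * (1 + c) ^ 3 / threeIsogeny c x + c ^ 3 * (1 + c) / x =
      ((c + c ^ 2) / (x + c + c ^ 2)) ^ 2 + (c + c ^ 2) / (x + c + c ^ 2) := by
    unfold threeIsogeny
    field_simp
    grind
  rw [CharTwo.add_sq]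
  linear_combination e1 + e2

theorem threeIsogeny_mem_traceFiber {c x : F}
    (hx : x ∈ traceFiber (c ^ 3 * (1 + c)) (Algebra.trace (ZMod 2) F c + 1)) :
    threeIsogeny c x ∈ traceFiber (c * (1 + c) ^ 3) (Algebra.trace (ZMod 2) F c + 1) := by
  obtain ⟨h1, h2⟩ := add_ne_zero_of_mem_traceFiber hx
  obtain ⟨hx0, hx⟩ := mem_traceFiber.mp hx
  refine mem_traceFiber.mpr ⟨?_, (trace_threeIsogeny hx0 h1 h2).trans hx⟩
  unfold threeIsogeny
  positivity

/-- In the coordinate t = c²/(x + c²) the isogeny is c²/t + c² + t² + t. A collision of t with u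
forces c² = tu(1+t+u), so c²/(t(1+t)²) has trace 0, whereas the fibre condition on x gives it trace
1. -/
theorem threeIsogeny_injOn {c : F} (hc0 : c ≠ 0) :
    Set.InjOn (threeIsogeny c)
      (traceFiber (c ^ 3 * (1 + c)) (Algebra.trace (ZMod 2) F c + 1) : Set F) := by
  have : CharP F 2 := charP_of_injective_algebraMap (algebraMap (ZMod 2) F).injective 2
  have two : (2 : F) = 0 := CharTwo.two_eq_zero
  intro x hx y hy hxy
  by_contra hne
  obtain ⟨hx1, -⟩ := add_ne_zero_of_mem_traceFiber hx
  obtain ⟨hy1, -⟩ := add_ne_zero_of_mem_traceFiber hy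
  obtain ⟨hx0, hxt⟩ := mem_traceFiber.mp hx
  obtain ⟨t, rfl⟩ : ∃ t, x = c ^ 2 / t + c ^ 2 := ⟨c ^ 2 / (x + c ^ 2), by
    field_simp; linear_combination (-c ^ 2) * two⟩
  obtain ⟨u, rfl⟩ : ∃ t, y = c ^ 2 / t + c ^ 2 := ⟨c ^ 2 / (y + c ^ 2), by
    field_simp; linear_combination (-c ^ 2) * two⟩
  have ht0 : t ≠ 0 := by
    rintro rfl
    apply hx1
    rw [div_zero]
    linear_combination c ^ 2 * two
  have hu0 : u ≠ 0 := by
    rintro rfl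
    apply hy1
    rw [div_zero]
    linear_combination c ^ 2 * two
  have ht1 : 1 + t ≠ 0 := by
    intro h
    apply hx0
    field_simp
    linear_combination c ^ 2 * h
  have hval (r : F) (hr : r ≠ 0) :
      threeIsogeny c (c ^ 2 / r + c ^ 2) = c ^ 2 / r + c ^ 2 + r ^ 2 + r := by
    have e : c ^ 2 / r + c ^ 2 + c ^ 2 = c ^ 2 / r := by linear_combination c ^ 2 * two
    unfold threeIsogeny
    rw [e]
    field_simp
    grind
  rw [hval t ht0, hval u hu0] at hxy
  have htu : t - u ≠ 0 := by
    intro h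
    apply hne
    rw [sub_eq_zero.mp h]
  have hroot : c ^ 2 = t * u * (1 + t + u) := by
    apply mul_left_cancel₀ htu
    field_simp at hxy
    linear_combination - hxy
  have hs : c ^ 2 / (t * (1 + t) ^ 2) = (u / (1 + t)) ^ 2 + u / (1 + t) := by
    rw [hroot]
    field_simp
    ring
  have h0 : Algebra.trace (ZMod 2) F (c ^ 2 / (t * (1 + t) ^ 2)) = 0 := by
    rw [hs, trace_sq_add_self]
  have h1 : Algebra.trace (ZMod 2) F (c ^ 2 / t + c ^ 2 + c ^ 3 * (1 + c) / (c ^ 2 / t + c ^ 2)) =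
      Algebra.trace (ZMod 2) F (c ^ 2 / (t * (1 + t) ^ 2) + c) := by
    apply trace_eq_of_add_eq_sq_add_self (s := c / (1 + t))
    have e : c ^ 2 / t + c ^ 2 = c ^ 2 * (1 + t) / t := by
      field_simp
    rw [e]
    field_simp
    grind
  rw [h1, map_add, h0, zero_add] at hxt
  simp at hxt

theorem threeIsogeny_surjOn (htr : Algebra.trace (ZMod 2) F (1 : F) = 1) {c : F}
    (hc0 : c ≠ 0) :
    Set.SurjOn (threeIsogeny c)
      (traceFiber (c ^ 3 * (1 + c)) (Algebra.trace (ZMod 2) F c + 1) : Set F)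
      (traceFiber (c * (1 + c) ^ 3) (Algebra.trace (ZMod 2) F c + 1) : Set F) := by
  have : CharP F 2 := charP_of_injective_algebraMap (algebraMap (ZMod 2) F).injective 2
  have two : (2 : F) = 0 := CharTwo.two_eq_zero
  intro z hz
  obtain ⟨hz0, hzt⟩ := mem_traceFiber.mp hz
  -- A preimage of z is a root t of t³ + t² + (c² + z)t + c². The shift w = 1 + t removes the
  -- quadratic term, leaving w³ + (1 + c² + z)w + z; Tr(1) = 1 cancels the offset in τ.
  have hp : Algebra.trace (ZMod 2) F ((1 + c ^ 2 + z) ^ 3 / z ^ 2) = 0 := by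
    rw [trace_eq_of_add_eq_sq_add_self (y := z + c * (1 + c) ^ 3 / z + c + 1)
      (s := (1 + c) ^ 3 / z + (1 + c))]
    · rw [map_add, map_add, hzt, htr]
      linear_combination (Algebra.trace (ZMod 2) F c + 1) * (CharTwo.two_eq_zero : (2 : ZMod 2) = 0)
    · field_simp
      grind
  obtain ⟨w, hw⟩ := exists_root_depressed_cubic htr hz0 hp
  obtain ⟨t, rfl⟩ : ∃ t, w = 1 + t := ⟨w - 1, by ring⟩
  have hcubic : t ^ 3 + t ^ 2 + (c ^ 2 + z) * t + c ^ 2 = 0 := by grind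
  have ht0 : t ≠ 0 := by
    rintro rfl
    apply hc0
    simpa using hcubic
  have ht1 : 1 + t ≠ 0 := by
    intro h
    apply hz0
    rw [h] at hw
    simpa using hw
  have e1 : c ^ 2 / t + c ^ 2 + c ^ 2 = c ^ 2 / t := by linear_combination c ^ 2 * two
  have hx0 : c ^ 2 / t + c ^ 2 ≠ 0 := by
    have e : c ^ 2 / t + c ^ 2 = c ^ 2 * (1 + t) / t := by field_simp
    rw [e]
    positivity
  have hx1 : c ^ 2 / t + c ^ 2 + c ^ 2 ≠ 0 := by
    rw [e1]
    positivity
  have hval : threeIsogeny c (c ^ 2 / t + c ^ 2) = z := by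
    unfold threeIsogeny
    rw [e1]
    field_simp
    grind
  have hx2 : c ^ 2 / t + c ^ 2 + c + c ^ 2 ≠ 0 := by
    intro h
    apply hz0
    rw [← hval]
    unfold threeIsogeny
    rw [h]
    simp
  refine ⟨c ^ 2 / t + c ^ 2, mem_traceFiber.mpr ⟨hx0, ?_⟩, hval⟩
  rw [← trace_threeIsogeny hx0 hx1 hx2, hval, hzt]

theorem card_traceFiber_le {c : F} (hc0 : c ≠ 0) :
    (traceFiber (c ^ 3 * (1 + c)) (Algebra.trace (ZMod 2) F c + 1)).card ≤
      (traceFiber (c * (1 + c) ^ 3) (Algebra.trace (ZMod 2) F c + 1)).card :=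
  Finset.card_le_card_of_injOn (threeIsogeny c)
    (fun _ hx => threeIsogeny_mem_traceFiber hx) (threeIsogeny_injOn hc0)

theorem card_traceFiber_eq {c : F} (hc0 : c ≠ 0) (hc1 : 1 + c ≠ 0) :
    (traceFiber (c ^ 3 * (1 + c)) (Algebra.trace (ZMod 2) F c + 1)).card =
      (traceFiber (c * (1 + c) ^ 3) (Algebra.trace (ZMod 2) F c + 1)).card := by
  have : CharP F 2 := charP_of_injective_algebraMap (algebraMap (ZMod 2) F).injective 2
  refine le_antisymm (card_traceFiber_le hc0) ?_
  have htr : ∀ t : ZMod 2, t = 0 ∨ t = 1 := by decide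
  rcases htr (Algebra.trace (ZMod 2) F (1 : F)) with h | h
  -- Here Tr(1 + c) = Tr(c), so replacing c by 1 + c swaps the two fibres and keeps τ.
  · have e : 1 + (1 + c) = c := by rw [← add_assoc, CharTwo.add_self_eq_zero, zero_add]
    have key := card_traceFiber_le hc1
    rwa [e, map_add, h, zero_add, mul_comm, mul_comm (1 + c)] at key
  · exact Finset.card_le_card_of_surjOn _ (threeIsogeny_surjOn h hc0)

theorem kloostermanSum_mul_add_one_pow_three (c : F) :
    kloostermanSum (c * (1 + c) ^ 3) = kloostermanSum (c ^ 3 * (1 + c)) := by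
  by_cases hc0 : c = 0
  · simp [hc0]
  by_cases hc1 : 1 + c = 0
  · simp [hc1]
  rw [kloostermanSum_eq_card_traceFiber _ (Algebra.trace (ZMod 2) F c + 1),
    kloostermanSum_eq_card_traceFiber _ (Algebra.trace (ZMod 2) F c + 1), card_traceFiber_eq hc0 hc1]

end Isogeny

theorem theorem5 {F : Type*} [Field F] [Fintype F] [DecidableEq F] [Algebra (ZMod 2) F]
    (m : ℕ) (hm : 0 < m) (hF : Fintype.card F = 2 ^ m)
    (b : F) (n k : ℚ) (bn bk : F) (hbn : IsRatPow b n bn) (hbk : IsRatPow b k bk)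
    (h : bn ^ 4 + 1 ≠ 0) :
    kloostermanSum ((bn * b ^ 2 + bk + 1) * (bn * b ^ 2 + bn + bk) ^ 3 / (bn ^ 4 + 1)) =
      kloostermanSum ((bn * b ^ 2 + bk + 1) ^ 3 * (bn * b ^ 2 + bn + bk) / (bn ^ 4 + 1)) := by

  have : CharP F 2 := charP_of_injective_algebraMap (algebraMap (ZMod 2) F).injective 2
  have two : (2 : F) = 0 := CharTwo.two_eq_zero
  have hd : bn + 1 ≠ 0 := by
    intro h0
    apply h
    rw [CharTwo.add_eq_zero.mp h0]
    linear_combination two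
  have h4 : bn ^ 4 + 1 = (bn + 1) ^ 4 := by
    linear_combination (-2 * bn ^ 3 - 3 * bn ^ 2 - 2 * bn) * two
  -- This c is chosen so that c and 1 + c have the two given factors as numerators; the four
  -- denominators multiply to (bn + 1)⁴ = bn⁴ + 1.
  have key := kloostermanSum_mul_add_one_pow_three ((bn * b ^ 2 + bk + 1) / (bn + 1))
  have hc : 1 + (bn * b ^ 2 + bk + 1) / (bn + 1) = (bn * b ^ 2 + bn + bk) / (bn + 1) := by
    field_simp
    linear_combination two
  rw [hc] at key
  rw [h4]
  convert key using 2 <;> field_simp
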